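/- For a finite nonempty set $X$ in a Euclidean space and a nonempty $\mathcal F\subseteq X$ let $$\mathrm{cost}_X(\mathcal F)=|\mathcal F|+\sum_{x\in X}\min_{f\in\mathcal F}\|x-f\|^2$$ be the squared facility-location cost, and let $\mathrm{OPT}(X)=\min_{\emptyset\ne\mathcal F\subseteq X}\mathrm{cost}_X(\mathcal F)$; $\mathcal F$ is optimal for $X$ if it attains this minimum. A random projection from $\mathbb R^m$ to $\mathbb R^d$ is a random linear map $G$ whose matrix has i.i.d. $\mathcal N(0,1/d)$ entries. Let $d=d(n)\ge 1$ be integers with $d(n)=o(\log n)$. Then there are scale factors $R(n)\ge 1$ and functions $\varepsilon(n)\to 0$ and $A(n)\to\infty$ as $n\to\infty$, depending only on the sequence $d$, such that for all integers $m\ge n\ge 1$ the set of scaled standard basis vectors $X=\{R(n)e_1,\dots,R(n)e_n\}\subset\mathbb R^m$ has $|X|=n$ and, with probability at least $2/3$ over a random projection $G:\mathbb R^m\to\mathbb R^{d(n)}$, both of the following hold: 1. $\mathrm{OPT}(GX)\le\varepsilon(n)\cdot\mathrm{OPT}(X)$; 2. an optimal solution for $GX$ exists, and every optimal solution $\widetilde{\mathcal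 F}\subseteq GX$ for $GX$, pulled back to $X$ as $\mathcal F=\{x\in X: Gx\in\widetilde{\mathcal F}\}$, satisfies $\mathrm{cost}_X(\mathcal F)\ge A(n)\cdot\mathrm{OPT}(X)$. -/

import Mathlib

open Filter Topology MeasureTheory ProbabilityTheory Asymptotics
open scoped NNReal ENNReal

noncomputable section

namespace SqFL

/-- The squared facility-location cost of a set `F` of open facilities for the dataset `X`, with
uniform opening cost `1`:  `|F| + ∑_{x ∈ X} min_{f ∈ F} ‖x - f‖²`.
(It is only used for nonempty `F`, where the infimum is a minimum.) -/
def cost {E : Type*} [NormedAddCommGroup E] (X F : Finset E) : ℝ :=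
  (F.card : ℝ) + ∑ x ∈ X, ⨅ f : F, ‖x - (f : E)‖ ^ 2

/-- A feasible solution for the dataset `X`: a nonempty set of facilities contained in `X`. -/
def IsSolution {E : Type*} (X F : Finset E) : Prop :=
  F ⊆ X ∧ F.Nonempty

/-- An optimal solution: a feasible solution of minimum cost. -/
def IsOptimal {E : Type*} [NormedAddCommGroup E] (X F : Finset E) : Prop :=
  IsSolution X F ∧ ∀ F' : Finset E, IsSolution X F' → cost X F ≤ cost X F'

/-- The optimal squared facility-location cost of the dataset `X`. -/
def optCost {E : Type*} [NormedAddCommGroup E] (X : Finset E) : ℝ :=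
  sInf (cost X '' {F | IsSolution X F})

/-- The law of the columns `g 0, …, g (m - 1)` of a random `d × m` matrix with i.i.d. entries
distributed as `N(0, 1/d)`; `g j i` is the entry in row `i` and column `j`. -/
def projLaw (d m : ℕ) : Measure (Fin m → Fin d → ℝ) :=
  Measure.pi fun _ : Fin m => Measure.pi fun _ : Fin d => gaussianReal 0 (1 / (d : ℝ≥0))

/-- The linear map `ℝ^m → ℝ^d` whose matrix has the columns `g j`. -/
def proj {d m : ℕ} (g : Fin m → Fin d → ℝ) :
    EuclideanSpace ℝ (Fin m) →ₗ[ℝ] EuclideanSpace ℝ (Fin d) :=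
  Matrix.toEuclideanLin (Matrix.of fun i j => g j i)

open Classical in
/-- The projected dataset `GX`. -/
def projImage {d m : ℕ} (g : Fin m → Fin d → ℝ) (X : Finset (EuclideanSpace ℝ (Fin m))) :
    Finset (EuclideanSpace ℝ (Fin d)) :=
  X.image (proj g)

open Classical in
/-- The facilities in `X` that correspond to a set `F` of facilities in `GX`. -/
def pullback {d m : ℕ} (g : Fin m → Fin d → ℝ) (X : Finset (EuclideanSpace ℝ (Fin m)))
    (F : Finset (EuclideanSpace ℝ (Fin d))) : Finset (EuclideanSpace ℝ (Fin m)) :=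
  X.filter fun x => proj g x ∈ F

open Classical in
/-- The scaled standard basis vectors `r e_0, …, r e_{n-1}` in `ℝ^m` (used for `n ≤ m`). -/
def scaledBasis (r : ℝ) (n m : ℕ) : Finset (EuclideanSpace ℝ (Fin m)) :=
  (Finset.univ.filter fun i : Fin m => i.val < n).image fun i => EuclideanSpace.single i r

end SqFL

end

/-!
Let `R = n ^ (1 / (6 d))`; the growth assumption on `d` says that `R → ∞`. Distinct points of
`X = {R e_i}` are at squared distance `2 R² ≥ 1`, so it is optimal to open every point of `X`, and
`OPT(X) = n`. Since `E ‖G x‖² = ‖x‖²`, Markov's inequality gives `∑ ‖G x‖² ≤ 3 n R²` with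
probability at least `2 / 3`. Then at most `3 n / R²` points of `G X` are outside of the ball of
radius `R²`, and by a volume bound the others have an `R⁻¹`-net of at most
`(1 + 2 R³) ^ d ≤ R ^ (4 d) ≤ n / R²` points. Opening the net and the outliers costs `O(n / R²)`.

An optimal solution for `G X` therefore opens only `O(n / R²)` facilities. As `G` is almost surely
injective on `X`, its pullback is no larger, and every other point of `X` pays at least `2 R²`.
-/

namespace SqFL

section Cost

variable {E : Type*} [NormedAddCommGroup E] {X F : Finset E}

lemma iInf_norm_sub_sq_nonneg (F : Finset E) (x : E) : 0 ≤ ⨅ f : F, ‖x - (f : E)‖ ^ 2 :=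
  Real.iInf_nonneg fun _ => sq_nonneg _

lemma iInf_norm_sub_sq_le (x : E) {f : E} (hf : f ∈ F) :
    ⨅ f : F, ‖x - (f : E)‖ ^ 2 ≤ ‖x - f‖ ^ 2 :=
  ciInf_le (f := fun f : F => ‖x - (f : E)‖ ^ 2)
    ⟨0, Set.forall_mem_range.2 fun _ => sq_nonneg _⟩ ⟨f, hf⟩

lemma card_le_cost (X F : Finset E) : (F.card : ℝ) ≤ cost X F :=
  le_add_of_nonneg_right (Finset.sum_nonneg fun x _ => iInf_norm_sub_sq_nonneg F x)

lemma cost_nonneg (X F : Finset E) : 0 ≤ cost X F :=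
  (Nat.cast_nonneg _).trans (card_le_cost X F)

lemma cost_le_of_isCover {ρ : ℝ≥0} (h : Metric.IsCover ρ (X : Set E) F) :
    cost X F ≤ F.card + X.card * (ρ : ℝ) ^ 2 := by
  rw [cost, ← nsmul_eq_mul]
  refine add_le_add_right (Finset.sum_le_card_nsmul X _ _ fun x hx => ?_) _
  obtain ⟨f, hf, hxf⟩ := h hx
  have hdist : ‖x - f‖ ≤ ρ := by
    rw [← dist_eq_norm]
    exact edist_le_coe.1 hxf
  exact (iInf_norm_sub_sq_le x hf).trans (by gcongr)

lemma IsSolution.card_add_mul_le_cost (hF : IsSolution X F) {b : ℝ}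
    (hX : (X : Set E).Pairwise fun x y => b ≤ ‖x - y‖ ^ 2) :
    F.card + ((X.card : ℝ) - F.card) * b ≤ cost X F := by
  classical
  have : Nonempty F := hF.2.coe_sort
  have hclosed : ∀ x ∈ X \ F, b ≤ ⨅ f : F, ‖x - (f : E)‖ ^ 2 := fun x hx => le_ciInf fun f =>
    hX (Finset.mem_sdiff.1 hx).1 (hF.1 f.2) fun h => (Finset.mem_sdiff.1 hx).2 (h ▸ f.2)
  refine add_le_add_right ?_ _
  calc ((X.card : ℝ) - F.card) * b
    _ = (X \ F).card • b := by
      rw [nsmul_eq_mul, Finset.card_sdiff_of_subset hF.1, Nat.cast_sub (Finset.card_le_card hF.1)]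
    _ ≤ ∑ x ∈ X \ F, ⨅ f : F, ‖x - (f : E)‖ ^ 2 := Finset.card_nsmul_le_sum _ _ _ hclosed
    _ ≤ ∑ x ∈ X, ⨅ f : F, ‖x - (f : E)‖ ^ 2 :=
      Finset.sum_le_sum_of_subset_of_nonneg Finset.sdiff_subset
        fun x _ _ => iInf_norm_sub_sq_nonneg F x

lemma optCost_le_cost (h : IsSolution X F) : optCost X ≤ cost X F :=
  csInf_le ⟨0, Set.forall_mem_image.2 fun F _ => cost_nonneg X F⟩ ⟨F, h, rfl⟩

lemma le_optCost (hX : X.Nonempty) {c : ℝ} (h : ∀ F, IsSolution X F → c ≤ cost X F) :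
    c ≤ optCost X :=
  le_csInf ⟨_, X, ⟨subset_rfl, hX⟩, rfl⟩ (Set.forall_mem_image.2 h)

lemma optCost_le_card (hX : X.Nonempty) : optCost X ≤ X.card :=
  (optCost_le_cost ⟨subset_rfl, hX⟩).trans <| by
    simpa using cost_le_of_isCover (Metric.IsCover.refl 0 (X : Set E))

lemma optCost_eq_card_of_pairwise (hX : X.Nonempty)
    (h : (X : Set E).Pairwise fun x y => 1 ≤ ‖x - y‖ ^ 2) : optCost X = X.card :=
  le_antisymm (optCost_le_card hX) <| le_optCost hX fun F hF => by
    simpa using hF.card_add_mul_le_cost h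

lemma exists_isOptimal (hX : X.Nonempty) : ∃ F, IsOptimal X F := by
  have hfin : {F | IsSolution X F}.Finite :=
    X.powerset.finite_toSet.subset fun F hF => Finset.mem_coe.2 (Finset.mem_powerset.2 hF.1)
  obtain ⟨F, hF, hmin⟩ := Set.exists_min_image _ (cost X) hfin ⟨X, subset_rfl, hX⟩
  exact ⟨F, hF, hmin⟩

lemma IsOptimal.cost_le_optCost (h : IsOptimal X F) : cost X F ≤ optCost X :=
  le_optCost (h.1.2.mono h.1.1) h.2

lemma card_filter_lt_norm_mul_sq_le (Y : Finset E) {T : ℝ} (hT : 0 ≤ T) :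
    (Y.filter fun y => T < ‖y‖).card * T ^ 2 ≤ ∑ y ∈ Y, ‖y‖ ^ 2 := by
  rw [← nsmul_eq_mul]
  calc (Y.filter fun y => T < ‖y‖).card • T ^ 2
    _ ≤ ∑ y ∈ Y with T < ‖y‖, ‖y‖ ^ 2 := Finset.card_nsmul_le_sum _ _ _ fun y hy =>
      pow_le_pow_left₀ hT (Finset.mem_filter.1 hy).2.le 2
    _ ≤ ∑ y ∈ Y, ‖y‖ ^ 2 := Finset.sum_le_sum_of_subset_of_nonneg (Finset.filter_subset _ _)
      fun _ _ _ => sq_nonneg _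

end Cost

section FiniteDimensional

variable {E : Type*} [NormedAddCommGroup E] [NormedSpace ℝ E] [FiniteDimensional ℝ E]

open Module (finrank)

lemma card_le_of_isSeparated_of_subset_closedBall {S : Finset E} {ρ : ℝ≥0} {c : E} {T : ℝ}
    (hρ : 0 < ρ) (hT : 0 ≤ T) (hsep : Metric.IsSeparated ρ (S : Set E))
    (hS : (S : Set E) ⊆ Metric.closedBall c T) : (S.card : ℝ) ≤ (1 + 2 * T / ρ) ^ finrank ℝ E := by
  borelize E
  let μ : Measure E := Measure.addHaar
  have hρ' : (0 : ℝ) < ρ / 2 := by positivity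
  have hdisj : (S : Set E).PairwiseDisjoint fun x => Metric.ball x (ρ / 2) := by
    refine fun x hx y hy hxy => Metric.ball_disjoint_ball ?_
    rw [add_halves]
    exact (not_le.1 fun h => (hsep hx hy hxy).not_ge (edist_le_coe.2 h)).le
  have hball (x : E) {r : ℝ} (hr : 0 < r) :
      μ.real (Metric.ball x r) = r ^ finrank ℝ E * μ.real (Metric.ball 0 1) := by
    rw [Measure.real, μ.addHaar_ball_of_pos x hr, ENNReal.toReal_mul,
      ENNReal.toReal_ofReal (by positivity), Measure.real]
  have hsub : (⋃ x ∈ S, Metric.ball x (ρ / 2)) ⊆ Metric.ball c (ρ / 2 + T) :=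
    Set.iUnion₂_subset fun x hx => Metric.ball_subset_ball' (by gcongr; exact hS hx)
  have hvol : S.card * μ.real (Metric.ball 0 (ρ / 2)) ≤ μ.real (Metric.ball c (ρ / 2 + T)) := by
    calc S.card * μ.real (Metric.ball 0 (ρ / 2))
      _ = ∑ x ∈ S, μ.real (Metric.ball x (ρ / 2)) := by
        simp [μ.addHaar_real_ball_center]
      _ = μ.real (⋃ x ∈ S, Metric.ball x (ρ / 2)) :=
        (measureReal_biUnion_finset hdisj fun _ _ => Metric.isOpen_ball.measurableSet).symm
      _ ≤ _ := measureReal_mono hsub measure_ball_lt_top.ne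
  have hunit : 0 < μ.real (Metric.ball 0 1) :=
    ENNReal.toReal_pos (Metric.measure_ball_pos μ _ one_pos).ne' measure_ball_lt_top.ne
  rw [hball 0 hρ', hball c (by positivity), ← mul_assoc,
    mul_le_mul_iff_left₀ hunit, ← le_div_iff₀ (by positivity), ← div_pow] at hvol
  have hratio : (ρ / 2 + T) / (ρ / 2) = 1 + 2 * T / ρ := by field_simp
  rwa [hratio] at hvol

lemma exists_isCover_card_le {A : Set E} (hA : A.Finite) {ρ : ℝ≥0} {c : E} {T : ℝ} (hρ : 0 < ρ)
    (hT : 0 ≤ T) (hAT : A ⊆ Metric.closedBall c T) :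
    ∃ S : Finset E, (S : Set E) ⊆ A ∧ Metric.IsCover ρ A S ∧
      (S.card : ℝ) ≤ (1 + 2 * T / ρ) ^ finrank ℝ E := by
  have hpack : Metric.packingNumber ρ A ≠ ⊤ :=
    ((Metric.packingNumber_le_encard_self A).trans_lt hA.encard_lt_top).ne
  have hsub : Metric.maximalSeparatedSet ρ A ⊆ A := Metric.maximalSeparatedSet_subset
  lift Metric.maximalSeparatedSet ρ A to Finset E using hA.subset hsub with S hS
  have hsep : Metric.IsSeparated ρ (S : Set E) := hS ▸ Metric.isSeparated_maximalSeparatedSet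
  exact ⟨S, hsub, hS ▸ Metric.isCover_maximalSeparatedSet hpack,
    card_le_of_isSeparated_of_subset_closedBall hρ hT hsep (hsub.trans hAT)⟩

-- Open a `ρ`-net of the points in the ball of radius `T` and every point outside of it.
lemma optCost_le_of_radius {Y : Finset E} (hY : Y.Nonempty) {ρ T : ℝ} (hρ : 0 < ρ) (hT : 0 < T) :
    optCost Y ≤ (1 + 2 * T / ρ) ^ finrank ℝ E + (∑ y ∈ Y, ‖y‖ ^ 2) / T ^ 2
      + Y.card * ρ ^ 2 := by
  classical
  lift ρ to ℝ≥0 using hρ.le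
  let near : Finset E := Y.filter fun y => ‖y‖ ≤ T
  let far : Finset E := Y.filter fun y => T < ‖y‖
  obtain ⟨S, hSnear, hScover, hScard⟩ := exists_isCover_card_le near.finite_toSet
    (NNReal.coe_pos.1 hρ) hT.le
    (c := 0) (fun y hy => mem_closedBall_zero_iff.2 (Finset.mem_filter.1 hy).2)
  have hcover : Metric.IsCover ρ (Y : Set E) (S ∪ far : Finset E) := by
    have hYsplit : near ∪ far = Y := by simp [near, far, ← Finset.filter_or, le_or_gt]
    rw [← hYsplit, Finset.coe_union, Finset.coe_union]
    exact SetRel.IsCover.union hScover (Metric.IsCover.refl ρ _)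
  have hsol : IsSolution Y (S ∪ far) :=
    ⟨Finset.union_subset ((Finset.coe_subset.1 hSnear).trans (Finset.filter_subset _ _))
      (Finset.filter_subset _ _), Finset.coe_nonempty.1 (hcover.nonempty hY)⟩
  have hfar : (far.card : ℝ) ≤ (∑ y ∈ Y, ‖y‖ ^ 2) / T ^ 2 :=
    (le_div_iff₀ (by positivity)).2 (card_filter_lt_norm_mul_sq_le Y hT.le)
  calc optCost Y
    _ ≤ (S ∪ far).card + Y.card * (ρ : ℝ) ^ 2 :=
      (optCost_le_cost hsol).trans (cost_le_of_isCover hcover)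
    _ ≤ S.card + far.card + Y.card * (ρ : ℝ) ^ 2 := by
      gcongr
      exact mod_cast Finset.card_union_le S far
    _ ≤ _ := by gcongr

-- The constant `9` makes the bound trivial for `R ≤ 3`.
lemma optCost_le_nine_div_sq_mul_card {Y : Finset E} {R : ℝ} (hR : 0 < R)
    (hE : finrank ℝ E ≠ 0) (hcard : R ^ (6 * finrank ℝ E) ≤ Y.card)
    (hsum : ∑ y ∈ Y, ‖y‖ ^ 2 ≤ 3 * (R ^ 2 * Y.card)) : optCost Y ≤ 9 / R ^ 2 * Y.card := by
  have hY : Y.Nonempty := Finset.card_pos.1 <| mod_cast (pow_pos hR _).trans_le hcard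
  rcases le_total R 3 with hR3 | hR3
  · have hratio : 1 ≤ 9 / R ^ 2 := (one_le_div (by positivity)).2 (by nlinarith)
    exact (optCost_le_card hY).trans (le_mul_of_one_le_left (Nat.cast_nonneg _) hratio)
  have hnet : (1 + 2 * R ^ 2 / R⁻¹) ^ finrank ℝ E ≤ Y.card / R ^ 2 := by
    have hbase : 1 + 2 * R ^ 2 / R⁻¹ ≤ R ^ 4 := by
      have hR1 : 1 ≤ R ^ 3 := one_le_pow₀ (by linarith)
      rw [div_inv_eq_mul]
      nlinarith
    rw [le_div_iff₀ (by positivity)]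
    calc (1 + 2 * R ^ 2 / R⁻¹) ^ finrank ℝ E * R ^ 2
      _ ≤ (R ^ 4) ^ finrank ℝ E * R ^ 2 := by gcongr
      _ = R ^ (4 * finrank ℝ E + 2) := by rw [← pow_mul, ← pow_add]
      _ ≤ R ^ (6 * finrank ℝ E) := pow_le_pow_right₀ (by linarith) (by omega)
      _ ≤ Y.card := hcard
  have hopt := optCost_le_of_radius hY (inv_pos.2 hR) (pow_pos hR 2)
  calc optCost Y
    _ ≤ Y.card / R ^ 2 + 3 * (R ^ 2 * Y.card) / (R ^ 2) ^ 2 + Y.card * R⁻¹ ^ 2 :=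
      hopt.trans (by gcongr)
    _ = 5 / R ^ 2 * Y.card := by field_simp; ring
    _ ≤ 9 / R ^ 2 * Y.card := by gcongr; norm_num

end FiniteDimensional

section Probability

variable {Ω : Type*} {mΩ : MeasurableSpace Ω} {P : Measure Ω}

lemma hasLaw_sum_gaussianReal_of_iIndepFun {ι : Type*} [Fintype ι] {X : ι → Ω → ℝ} {μ : ι → ℝ}
    {v : ι → ℝ≥0} (hX : ∀ i, HasLaw (X i) (gaussianReal (μ i) (v i)) P) (hind : iIndepFun X P) :
    HasLaw (fun ω => ∑ i, X i ω) (gaussianReal (∑ i, μ i) (∑ i, v i)) P := by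
  have hgauss (i : ι) : HasGaussianLaw (X i) P := (hX i).hasGaussianLaw
  have hsum : HasGaussianLaw (fun ω => ∑ i, X i ω) P := hind.hasGaussianLaw_fun_sum hgauss
  have hmean : ∫ ω, ∑ i, X i ω ∂P = ∑ i, μ i := by
    rw [integral_finsetSum _ fun i _ => (hgauss i).integrable]
    exact Finset.sum_congr rfl fun i _ => (hX i).integral_eq.trans integral_id_gaussianReal
  have hvar : Var[fun ω => ∑ i, X i ω; P] = ∑ i, (v i : ℝ) := by
    rw [← Finset.sum_fn, IndepFun.variance_sum (fun i _ => (hgauss i).memLp_two)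
      fun i _ j _ hij => hind.indepFun hij]
    exact Finset.sum_congr rfl fun i _ => (hX i).variance_eq.trans variance_id_gaussianReal
  refine ⟨hsum.aemeasurable, ?_⟩
  rw [hsum.map_eq_gaussianReal, hmean, hvar, ← NNReal.coe_sum, Real.toNNReal_coe]

lemma one_sub_integral_div_le_measureReal_le [IsProbabilityMeasure P] {f : Ω → ℝ}
    (hf : Integrable f P) (hf_nonneg : 0 ≤ᵐ[P] f) {b : ℝ} (hb : 0 < b) :
    1 - (∫ ω, f ω ∂P) / b ≤ P.real {ω | f ω ≤ b} := by
  have hmarkov : P.real {ω | b ≤ f ω} ≤ (∫ ω, f ω ∂P) / b :=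
    (le_div_iff₀' hb).2 (mul_meas_ge_le_integral_of_nonneg hf_nonneg hf b)
  have hcover : 1 ≤ P.real {ω | b ≤ f ω} + P.real {ω | f ω ≤ b} := by
    rw [← probReal_univ (μ := P)]
    exact (measureReal_mono fun ω _ => le_total b (f ω)).trans (measureReal_union_le _ _)
  linarith

end Probability

section Projection

variable {d m : ℕ}

instance (d m : ℕ) : IsProbabilityMeasure (projLaw d m) := by
  unfold projLaw
  infer_instance

lemma proj_apply (g : Fin m → Fin d → ℝ) (x : EuclideanSpace ℝ (Fin m)) (i : Fin d) :
    proj g x i = ∑ j, x j * g j i := by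
  simp [proj, Matrix.toLpLin_apply, Matrix.mulVec, dotProduct, mul_comm]

lemma hasLaw_proj_apply (x : EuclideanSpace ℝ (Fin m)) (i : Fin d) :
    HasLaw (fun g => proj g x i) (gaussianReal 0 (‖x‖₊ ^ 2 / d)) (projLaw d m) := by
  have hentry (j : Fin m) :
      HasLaw (fun g => g j i) (gaussianReal 0 (1 / (d : ℝ≥0))) (projLaw d m) :=
    ((measurePreserving_eval (fun _ : Fin d => gaussianReal 0 (1 / (d : ℝ≥0))) i).comp
      (measurePreserving_eval _ j)).hasLaw
  have hind : iIndepFun (fun j (g : Fin m → Fin d → ℝ) => x j * g j i) (projLaw d m) :=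
    iIndepFun_pi (X := fun j (r : Fin d → ℝ) => x j * r i) fun j =>
      (measurable_const.mul (measurable_pi_apply i)).aemeasurable
  have hlaw := hasLaw_sum_gaussianReal_of_iIndepFun
    (fun j => gaussianReal_const_mul (hentry j) (x j)) hind
  have hvar : ‖x‖₊ ^ 2 / d = ∑ j, NNReal.mk (x j ^ 2) (sq_nonneg _) * (1 / (d : ℝ≥0)) := by
    ext
    simp [EuclideanSpace.real_norm_sq_eq, Finset.sum_mul, div_eq_mul_inv]
  simpa only [proj_apply, hvar, mul_zero, Finset.sum_const_zero] using hlaw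

lemma memLp_proj_apply (x : EuclideanSpace ℝ (Fin m)) (i : Fin d) :
    MemLp (fun g => proj g x i) 2 (projLaw d m) :=
  (hasLaw_proj_apply x i).hasGaussianLaw.memLp_two

lemma integrable_norm_proj_sq (x : EuclideanSpace ℝ (Fin m)) :
    Integrable (fun g => ‖proj g x‖ ^ 2) (projLaw d m) := by
  simp only [EuclideanSpace.real_norm_sq_eq]
  exact integrable_finsetSum _ fun i _ => (memLp_proj_apply x i).integrable_sq

lemma integral_norm_proj_sq (hd : d ≠ 0) (x : EuclideanSpace ℝ (Fin m)) :
    ∫ g, ‖proj g x‖ ^ 2 ∂projLaw d m = ‖x‖ ^ 2 := by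
  have hcoord (i : Fin d) : ∫ g, proj g x i ^ 2 ∂projLaw d m = ‖x‖ ^ 2 / d := by
    have hlaw := hasLaw_proj_apply x i
    rw [← variance_of_integral_eq_zero hlaw.aemeasurable
      (hlaw.integral_eq.trans integral_id_gaussianReal), hlaw.variance_eq, variance_id_gaussianReal]
    simp
  simp only [EuclideanSpace.real_norm_sq_eq (proj _ x)]
  rw [integral_finsetSum _ fun i _ => (memLp_proj_apply x i).integrable_sq,
    Finset.sum_congr rfl fun i _ => hcoord i, Finset.sum_const, Finset.card_fin, nsmul_eq_mul,
    mul_div_cancel₀ _ (Nat.cast_ne_zero.2 hd)]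

lemma two_thirds_le_projLaw_sum_norm_proj_sq_le (hd : d ≠ 0)
    {X : Finset (EuclideanSpace ℝ (Fin m))} {b : ℝ} (hb : 0 < b) (hX : ∑ x ∈ X, ‖x‖ ^ 2 ≤ b) :
    2 / 3 ≤ projLaw d m {g | ∑ x ∈ X, ‖proj g x‖ ^ 2 ≤ 3 * b} := by
  have hmean : ∫ g, ∑ x ∈ X, ‖proj g x‖ ^ 2 ∂projLaw d m = ∑ x ∈ X, ‖x‖ ^ 2 := by
    rw [integral_finsetSum _ fun x _ => integrable_norm_proj_sq x]
    exact Finset.sum_congr rfl fun x _ => integral_norm_proj_sq hd x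
  have hmarkov := one_sub_integral_div_le_measureReal_le (P := projLaw d m)
    (integrable_finsetSum X fun x _ => integrable_norm_proj_sq x)
    (.of_forall fun g => Finset.sum_nonneg fun x _ => sq_nonneg ‖proj g x‖)
    (mul_pos three_pos hb)
  have hratio : (2 / 3 : ℝ) ≤ 1 - (∑ x ∈ X, ‖x‖ ^ 2) / (3 * b) := by
    have : (∑ x ∈ X, ‖x‖ ^ 2) / (3 * b) ≤ 1 / 3 :=
      (div_le_div_iff₀ (by positivity) three_pos).2 (by linarith)
    linarith
  rw [hmean] at hmarkov
  calc (2 / 3 : ℝ≥0∞)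
    _ = ENNReal.ofReal (2 / 3) := by simp [ENNReal.ofReal_div_of_pos]
    _ ≤ _ := (ENNReal.ofReal_le_ofReal (hratio.trans hmarkov)).trans_eq
      (ofReal_measureReal (measure_ne_top _ _))

lemma ae_proj_ne_zero (hd : d ≠ 0) {x : EuclideanSpace ℝ (Fin m)} (hx : x ≠ 0) :
    ∀ᵐ g ∂projLaw d m, proj g x ≠ 0 := by
  have hlaw := hasLaw_proj_apply x ⟨0, Nat.pos_of_ne_zero hd⟩
  have := nullSingletonClass_gaussianReal (μ := 0) (v := ‖x‖₊ ^ 2 / d)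
    (div_ne_zero (pow_ne_zero 2 (nnnorm_ne_zero_iff.2 hx)) (Nat.cast_ne_zero.2 hd))
  have hcoord : ∀ᵐ g ∂projLaw d m, proj g x ⟨0, Nat.pos_of_ne_zero hd⟩ ≠ 0 :=
    (hlaw.ae_iff (p := (· ≠ 0)) (by fun_prop)).2 (Measure.ae_ne _ 0)
  filter_upwards [hcoord] with g hg h
  exact hg (by simp [h])

lemma ae_injOn_proj (hd : d ≠ 0) {X : Set (EuclideanSpace ℝ (Fin m))} (hX : X.Countable) :
    ∀ᵐ g ∂projLaw d m, Set.InjOn (proj g) X := by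
  have hpair : ∀ᵐ g ∂projLaw d m, ∀ x ∈ X, ∀ y ∈ X, x ≠ y → proj g (x - y) ≠ 0 := by
    simp only [ae_ball_iff hX, ae_all_iff]
    exact fun x _ y _ hxy => ae_proj_ne_zero hd (sub_ne_zero.2 hxy)
  filter_upwards [hpair] with g hg x hx y hy hxy
  by_contra hne
  exact hg x hx y hy hne (by rw [map_sub, hxy, sub_self])

end Projection

section Pullback

variable {d m : ℕ} {g : Fin m → Fin d → ℝ} {X : Finset (EuclideanSpace ℝ (Fin m))}
  {F : Finset (EuclideanSpace ℝ (Fin d))}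

lemma card_projImage (hg : Set.InjOn (proj g) X) : (projImage g X).card = X.card :=
  Finset.card_image_of_injOn hg

lemma optCost_projImage_le (hg : Set.InjOn (proj g) X) {R : ℝ} (hR : 0 < R) (hd : d ≠ 0)
    (hcard : R ^ (6 * d) ≤ X.card) (hsum : ∑ x ∈ X, ‖proj g x‖ ^ 2 ≤ 3 * (R ^ 2 * X.card)) :
    optCost (projImage g X) ≤ 9 / R ^ 2 * X.card := by
  classical
  rw [← card_projImage hg] at hcard hsum ⊢
  have himage : ∑ y ∈ projImage g X, ‖y‖ ^ 2 = ∑ x ∈ X, ‖proj g x‖ ^ 2 := Finset.sum_image hg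
  exact optCost_le_nine_div_sq_mul_card hR (by rwa [finrank_euclideanSpace_fin])
    (by rwa [finrank_euclideanSpace_fin]) (himage.trans_le hsum)

lemma IsSolution.pullback (hF : IsSolution (projImage g X) F) :
    IsSolution X (pullback g X F) := by
  classical
  obtain ⟨y, hy⟩ := hF.2
  obtain ⟨x, hx, rfl⟩ := Finset.mem_image.1 (hF.1 hy)
  exact ⟨Finset.filter_subset _ _, x, Finset.mem_filter.2 ⟨hx, hy⟩⟩

lemma card_pullback_le (hg : Set.InjOn (proj g) X) (F : Finset (EuclideanSpace ℝ (Fin d))) :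
    (pullback g X F).card ≤ F.card :=
  Finset.card_le_card_of_injOn (proj g) (fun _ hx => (Finset.mem_filter.1 hx).2)
    (hg.mono (Finset.filter_subset _ _))

lemma le_cost_pullback (hg : Set.InjOn (proj g) X) {b c : ℝ} (hb : 0 ≤ b)
    (hX : (X : Set (EuclideanSpace ℝ (Fin m))).Pairwise fun x y => b ≤ ‖x - y‖ ^ 2)
    (hF : IsSolution (projImage g X) F) (hcard : F.card ≤ c * X.card) :
    (1 - c) * b * X.card ≤ cost X (pullback g X F) := by
  have hpullback : ((pullback g X F).card : ℝ) ≤ c * X.card :=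
    (Nat.cast_le.2 (card_pullback_le hg F)).trans hcard
  calc (1 - c) * b * X.card
    _ = (X.card - c * X.card) * b := by ring
    _ ≤ (X.card - (pullback g X F).card) * b := by gcongr
    _ ≤ (pullback g X F).card + (X.card - (pullback g X F).card) * b :=
      le_add_of_nonneg_left (Nat.cast_nonneg _)
    _ ≤ cost X (pullback g X F) := hF.pullback.card_add_mul_le_cost hX

lemma two_thirds_le_projLaw_optCost_le_and_le_cost_pullback (hd : d ≠ 0) {R b : ℝ} (hR : 0 < R)
    (hcard : R ^ (6 * d) ≤ X.card) (hsum : ∑ x ∈ X, ‖x‖ ^ 2 ≤ R ^ 2 * X.card) (hb : 0 ≤ b)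
    (hX : (X : Set (EuclideanSpace ℝ (Fin m))).Pairwise fun x y => b ≤ ‖x - y‖ ^ 2) :
    2 / 3 ≤ projLaw d m {g | optCost (projImage g X) ≤ 9 / R ^ 2 * X.card ∧
      (∃ F, IsOptimal (projImage g X) F) ∧ ∀ F, IsOptimal (projImage g X) F →
        (1 - 9 / R ^ 2) * b * X.card ≤ cost X (pullback g X F)} := by
  classical
  have hcard_pos : (0 : ℝ) < X.card := (pow_pos hR _).trans_le hcard
  have hne : X.Nonempty := Finset.card_pos.1 (mod_cast hcard_pos)
  have hprob := two_thirds_le_projLaw_sum_norm_proj_sq_le hd (by positivity) hsum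
  refine hprob.trans (measure_mono_ae ?_)
  filter_upwards [ae_injOn_proj hd X.countable_toSet] with g hg hgsum
  have hopt := optCost_projImage_le hg hR hd hcard hgsum
  exact ⟨hopt, exists_isOptimal (hne.image _), fun F hF => le_cost_pullback hg hb hX hF.1 <|
    (card_le_cost _ F).trans (hF.cost_le_optCost.trans hopt)⟩

end Pullback

section ScaledBasis

variable {n m : ℕ} {r : ℝ}

lemma card_scaledBasis (hr : r ≠ 0) (hnm : n ≤ m) : (scaledBasis r n m).card = n := by
  classical
  have hinj : Function.Injective fun i : Fin m => EuclideanSpace.single i r := fun i j hij => by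
    by_contra hne
    have := congrArg (fun x : EuclideanSpace ℝ (Fin m) => x i) hij
    simp [hne, hr] at this
  rw [scaledBasis, Finset.card_image_of_injective _ hinj, Fin.card_filter_val_lt, min_eq_right hnm]

lemma sum_norm_sq_scaledBasis (r : ℝ) (n m : ℕ) :
    ∑ x ∈ scaledBasis r n m, ‖x‖ ^ 2 = r ^ 2 * (scaledBasis r n m).card := by
  classical
  have hnorm : ∀ x ∈ scaledBasis r n m, ‖x‖ ^ 2 = r ^ 2 := Finset.forall_mem_image.2 fun i _ => by
    rw [PiLp.norm_single, Real.norm_eq_abs, sq_abs]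
  rw [Finset.sum_congr rfl hnorm, Finset.sum_const, nsmul_eq_mul, mul_comm]

lemma pairwise_scaledBasis (r : ℝ) (n m : ℕ) :
    (scaledBasis r n m : Set (EuclideanSpace ℝ (Fin m))).Pairwise
      fun x y => 2 * r ^ 2 ≤ ‖x - y‖ ^ 2 := by
  intro x hx y hy hxy
  obtain ⟨i, -, rfl⟩ := Finset.mem_image.1 (Finset.mem_coe.1 hx)
  obtain ⟨j, -, rfl⟩ := Finset.mem_image.1 (Finset.mem_coe.1 hy)
  have hij : i ≠ j := by
    rintro rfl
    exact hxy rfl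
  rw [norm_sub_sq_real, EuclideanSpace.inner_single_left]
  simp only [PiLp.norm_single, Real.norm_eq_abs, sq_abs, PiLp.single_apply, hij,
    if_false, mul_zero, sub_zero]
  linarith

lemma optCost_scaledBasis (hr : 1 ≤ r) (hn : n ≠ 0) (hnm : n ≤ m) :
    optCost (scaledBasis r n m) = n := by
  have hcard : (scaledBasis r n m).card = n := card_scaledBasis (by positivity) hnm
  have hsep := (pairwise_scaledBasis r n m).mono' fun x y hxy =>
    (by nlinarith : (1 : ℝ) ≤ 2 * r ^ 2).trans hxy
  rw [optCost_eq_card_of_pairwise (Finset.card_ne_zero.1 (hcard.trans_ne hn)) hsep, hcard]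

end ScaledBasis

section Scale

lemma tendsto_div_atTop_of_isLittleO {α : Type*} {l : Filter α} {f g : α → ℝ} (h : f =o[l] g)
    (hf : ∀ᶠ x in l, 0 < f x) (hg : ∀ᶠ x in l, 0 < g x) :
    Tendsto (fun x => g x / f x) l atTop := by
  have hratio : Tendsto (fun x => f x / g x) l (𝓝[>] 0) :=
    tendsto_nhdsWithin_iff.2 ⟨h.tendsto_div_nhds_zero, hf.mp (hg.mono fun _ => flip div_pos)⟩
  simpa only [Function.comp_def, inv_div] using tendsto_inv_nhdsGT_zero.comp hratio

/-- The factor `n ^ (1 / (6 d))` by which the basis vectors are scaled. It is written as an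
exponential so that it is at least `1` for `n = 0` as well. -/
noncomputable def scale (d n : ℕ) : ℝ := Real.exp (Real.log n / (6 * d))

lemma one_le_scale (d n : ℕ) : 1 ≤ scale d n :=
  Real.one_le_exp (div_nonneg (Real.log_natCast_nonneg n) (by positivity))

lemma scale_pow {d n : ℕ} (hd : d ≠ 0) (hn : n ≠ 0) : scale d n ^ (6 * d) = n := by
  rw [scale, ← Real.exp_nat_mul, Nat.cast_mul, Nat.cast_ofNat,
    mul_div_cancel₀ _ (by positivity), Real.exp_log (by positivity)]

lemma tendsto_scale_atTop {d : ℕ → ℕ} (hd_ne : ∀ n, d n ≠ 0)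
    (hd : (fun n => (d n : ℝ)) =o[atTop] fun n => Real.log (n : ℝ)) :
    Tendsto (fun n => scale (d n) n) atTop atTop := by
  have hlog : Tendsto (fun n : ℕ => Real.log n) atTop atTop :=
    Real.tendsto_log_atTop.comp tendsto_natCast_atTop_atTop
  have hratio := tendsto_div_atTop_of_isLittleO hd
    (.of_forall fun n => Nat.cast_pos.2 (Nat.pos_of_ne_zero (hd_ne n))) (hlog.eventually_gt_atTop 0)
  refine Real.tendsto_exp_atTop.comp ((hratio.atTop_div_const (r := 6) (by norm_num)).congr ?_)
  exact fun n => by rw [div_div, mul_comm]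

end Scale

end SqFL

theorem theoremF8 (d : ℕ → ℕ) (hd_pos : ∀ n, 1 ≤ d n)
    (hd : (fun n : ℕ => (d n : ℝ)) =o[atTop] fun n : ℕ => Real.log (n : ℝ)) :
    ∃ R ε A : ℕ → ℝ,
      (∀ n, 1 ≤ R n) ∧ Tendsto ε atTop (𝓝 0) ∧ Tendsto A atTop atTop ∧
      ∀ n m : ℕ, 1 ≤ n → n ≤ m →
        (SqFL.scaledBasis (R n) n m).card = n ∧
        2 / 3 ≤ SqFL.projLaw (d n) m
          {g | SqFL.optCost (SqFL.projImage g (SqFL.scaledBasis (R n) n m))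
                ≤ ε n * SqFL.optCost (SqFL.scaledBasis (R n) n m) ∧
            (∃ F, SqFL.IsOptimal (SqFL.projImage g (SqFL.scaledBasis (R n) n m)) F) ∧
            ∀ F, SqFL.IsOptimal (SqFL.projImage g (SqFL.scaledBasis (R n) n m)) F →
              A n * SqFL.optCost (SqFL.scaledBasis (R n) n m)
                ≤ SqFL.cost (SqFL.scaledBasis (R n) n m)
                    (SqFL.pullback g (SqFL.scaledBasis (R n) n m) F)} := by
  have hd_ne (n : ℕ) : d n ≠ 0 := Nat.one_le_iff_ne_zero.1 (hd_pos n)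
  let R (n : ℕ) : ℝ := SqFL.scale (d n) n
  have hR (n : ℕ) : 1 ≤ R n := SqFL.one_le_scale (d n) n
  have hRsq : Tendsto (fun n => R n ^ 2) atTop atTop :=
    (tendsto_pow_atTop two_ne_zero).comp (SqFL.tendsto_scale_atTop hd_ne hd)
  have hε : Tendsto (fun n => 9 / R n ^ 2) atTop (𝓝 0) := hRsq.const_div_atTop 9
  have hA : Tendsto (fun n => (1 - 9 / R n ^ 2) * (2 * R n ^ 2)) atTop atTop :=
    (hε.const_sub 1).pos_mul_atTop (by simp) (hRsq.const_mul_atTop two_pos)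
  refine ⟨R, _, _, hR, hε, hA, fun n m hn hnm => ?_⟩
  have hn_ne : n ≠ 0 := Nat.one_le_iff_ne_zero.1 hn
  have hR_pos : 0 < R n := zero_lt_one.trans_le (hR n)
  have hcard := SqFL.card_scaledBasis hR_pos.ne' hnm
  have hprob := SqFL.two_thirds_le_projLaw_optCost_le_and_le_cost_pullback (hd_ne n) hR_pos
    (by rw [SqFL.scale_pow (hd_ne n) hn_ne, hcard])
    (SqFL.sum_norm_sq_scaledBasis (R n) n m).le (by positivity)
    (SqFL.pairwise_scaledBasis (R n) n m)
  rw [hcard] at hprob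
  refine ⟨hcard, ?_⟩
  rwa [SqFL.optCost_scaledBasis (hR n) hn_ne hnm]
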